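/- Let $n\ge 3$, let $M$ be a closed (compact, without boundary) smooth $n$-manifold, let $V_0\in\mathbb{R}$, and let $(g_j)_{j\ge 1}$ be a sequence of smooth Riemannian metrics on $M$ whose scalar curvatures and total volumes satisfy $$R_{g_j}\ge -\frac1j \quad\text{and}\quad \mathrm{Vol}(M,g_j)\le V_0\qquad\text{for all } j\ge 1 .$$ Two Riemannian metrics $g,g_0$ on $M$ are called conformal if $g=e^{2f}g_0$ for some function $f\in C^2(M)$. Then the following hold for every $j\ge 1$. (1) If $g_{0,j}$ is a smooth Riemannian metric on $M$ such that $g_j$ is conformal to $g_{0,j}$ and $R_{g_{0,j}}\equiv -1$, then $$\mathrm{Vol}(M,g_{0,j})\le \frac{V_0}{j^{n/2}},$$ and hence also $\mathrm{Vol}(M,g_{0,j})\le V_0/j^{3/2}$. (2) If $\tilde g_{0,j}$ is a smooth Riemannian metric on $M$ such that $g_j$ is conformal to $\tilde g_{0,j}$, the scalar curvature of $\tilde g_{0,j}$ is a negative constant $\tilde R_{0,j}$, and $\mathrm{Vol}(M,\tilde g_{0,j})=1$, then $$0>\tilde R_{0,j}\ge -\frac{V_0^{2/n}}{j},$$ which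 for $n=3$ is $0>\tilde R_{0,j}\ge -V_0^{2/3}/j$. -/

import Mathlib

open scoped Manifold ContDiff

noncomputable section

/-! ### Scalar curvature of a matrix-valued function on `ℝⁿ` -/

/-- The partial derivative `∂ᵢ F` of a real function on `ℝⁿ`. -/
def coordDeriv {n : ℕ} (i : Fin n) (F : EuclideanSpace ℝ (Fin n) → ℝ)
    (y : EuclideanSpace ℝ (Fin n)) : ℝ :=
  fderiv ℝ F y (EuclideanSpace.single i 1)

/-- The Christoffel symbol
`Γᵏᵢⱼ = ½ ∑ₗ Gᵏˡ (∂ᵢ Gⱼₗ + ∂ⱼ Gᵢₗ - ∂ₗ Gᵢⱼ)` of a metric with coordinate matrix `G`. -/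
def coordChristoffel {n : ℕ} (G : EuclideanSpace ℝ (Fin n) → Matrix (Fin n) (Fin n) ℝ)
    (k i j : Fin n) (y : EuclideanSpace ℝ (Fin n)) : ℝ :=
  (1 / 2) * ∑ l, (G y)⁻¹ k l *
    (coordDeriv i (fun z => G z j l) y + coordDeriv j (fun z => G z i l) y
      - coordDeriv l (fun z => G z i j) y)

/-- The Ricci curvature
`Rⱼₖ = ∑ᵢ (∂ᵢ Γⁱⱼₖ - ∂ⱼ Γⁱᵢₖ + ∑ₗ (Γⁱᵢₗ Γˡⱼₖ - Γⁱⱼₗ Γˡᵢₖ))` of a metric with coordinate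
matrix `G`. -/
def coordRicci {n : ℕ} (G : EuclideanSpace ℝ (Fin n) → Matrix (Fin n) (Fin n) ℝ)
    (j k : Fin n) (y : EuclideanSpace ℝ (Fin n)) : ℝ :=
  ∑ i, (coordDeriv i (coordChristoffel G i j k) y - coordDeriv j (coordChristoffel G i i k) y
    + ∑ l, (coordChristoffel G i i l y * coordChristoffel G l j k y
      - coordChristoffel G i j l y * coordChristoffel G l i k y))

/-- The scalar curvature `∑ⱼₖ Gʲᵏ Rⱼₖ` (the trace of the Ricci curvature) of a metric with
coordinate matrix `G`. -/
def coordScalar {n : ℕ} (G : EuclideanSpace ℝ (Fin n) → Matrix (Fin n) (Fin n) ℝ)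
    (y : EuclideanSpace ℝ (Fin n)) : ℝ :=
  ∑ j, ∑ k, (G y)⁻¹ j k * coordRicci G j k y

/-! ### Riemannian metrics on a manifold -/

/-- Smooth Riemannian metrics on the `n`-manifold `M` (without boundary). -/
abbrev SmoothMetric (n : ℕ) (M : Type*) [TopologicalSpace M]
    [ChartedSpace (EuclideanSpace ℝ (Fin n)) M] [IsManifold (𝓡 n) ∞ M] :=
  Bundle.ContMDiffRiemannianMetric (𝓡 n) ∞ (EuclideanSpace ℝ (Fin n))
    (fun x : M => TangentSpace (𝓡 n) x)

namespace SmoothMetric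

variable {n : ℕ} {M : Type*} [TopologicalSpace M]
  [ChartedSpace (EuclideanSpace ℝ (Fin n)) M] [IsManifold (𝓡 n) ∞ M]

/-- The matrix of coefficients `gᵢⱼ = g(∂ᵢ, ∂ⱼ)` of `g` in the preferred chart `φ` at `c`, as a
function of the coordinates `y` (meaningful for `y` in the image of the chart). The coordinate
vector `∂ᵢ` at the point `φ⁻¹(y)` is the image of the `i`-th unit vector under the
differential of `φ⁻¹` at `y`. -/
def chartMatrix (g : SmoothMetric n M) (c : M) (y : EuclideanSpace ℝ (Fin n)) :
    Matrix (Fin n) (Fin n) ℝ :=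
  Matrix.of fun i j =>
    g.inner ((chartAt (EuclideanSpace ℝ (Fin n)) c).symm y)
      (mfderiv (𝓡 n) (𝓡 n) (chartAt (EuclideanSpace ℝ (Fin n)) c).symm y
        (EuclideanSpace.single i (1 : ℝ) : EuclideanSpace ℝ (Fin n)))
      (mfderiv (𝓡 n) (𝓡 n) (chartAt (EuclideanSpace ℝ (Fin n)) c).symm y
        (EuclideanSpace.single j (1 : ℝ) : EuclideanSpace ℝ (Fin n)))

/-- The scalar curvature `R_g(x)`, computed in the preferred chart at `x` (it does not depend on
the chart). -/
def scalarCurvature (g : SmoothMetric n M) (x : M) : ℝ :=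
  coordScalar (g.chartMatrix x) (chartAt (EuclideanSpace ℝ (Fin n)) x x)

/-- `g` is conformal to `g₀`: there is a `C²` function `f` with `g = e^{2f} g₀`. -/
def IsConformalTo (g g₀ : SmoothMetric n M) : Prop :=
  ∃ f : M → ℝ, ContMDiff (𝓡 n) 𝓘(ℝ, ℝ) 2 f ∧
    ∀ (x : M) (v w : TangentSpace (𝓡 n) x),
      g.inner x v w = Real.exp (2 * f x) * g₀.inner x v w

end SmoothMetric

/-! ### Riemannian volume -/

/-- A smooth partition of unity `(ρ_c)`, indexed by the points `c` of `M`, with `ρ_c` supported in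
the domain of the preferred chart at `c`. -/
def chartPartition (n : ℕ) (M : Type*) [TopologicalSpace M]
    [ChartedSpace (EuclideanSpace ℝ (Fin n)) M] [IsManifold (𝓡 n) ∞ M]
    [T2Space M] [SigmaCompactSpace M] : SmoothPartitionOfUnity M (𝓡 n) M Set.univ :=
  Classical.choose (SmoothPartitionOfUnity.exists_isSubordinate_chartAt_source (𝓡 n) M)

theorem chartPartition_isSubordinate (n : ℕ) (M : Type*) [TopologicalSpace M]
    [ChartedSpace (EuclideanSpace ℝ (Fin n)) M] [IsManifold (𝓡 n) ∞ M]
    [T2Space M] [SigmaCompactSpace M] :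
    (chartPartition n M).IsSubordinate
      (fun c : M => (chartAt (EuclideanSpace ℝ (Fin n)) c).source) :=
  Classical.choose_spec (SmoothPartitionOfUnity.exists_isSubordinate_chartAt_source (𝓡 n) M)

/-- The Riemannian volume measure of `g`, glued from the charts by a partition of unity:
`∫ u dV_g = ∑_c ∫_{φ_c(U_c)} ((ρ_c u) ∘ φ_c⁻¹) √(det (gᵢⱼ)) dy`, where `φ_c : U_c → ℝⁿ` is the
preferred chart at `c` (it does not depend on the choice of the partition of unity). -/
def SmoothMetric.volumeMeasure {n : ℕ} {M : Type*} [TopologicalSpace M]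
    [ChartedSpace (EuclideanSpace ℝ (Fin n)) M] [IsManifold (𝓡 n) ∞ M]
    [T2Space M] [SigmaCompactSpace M] [MeasurableSpace M] [BorelSpace M]
    (g : SmoothMetric n M) : MeasureTheory.Measure M :=
  MeasureTheory.Measure.sum fun c : M =>
    (((MeasureTheory.volume : MeasureTheory.Measure (EuclideanSpace ℝ (Fin n))).restrict
        (chartAt (EuclideanSpace ℝ (Fin n)) c).target).withDensity fun y =>
      ENNReal.ofReal (chartPartition n M c ((chartAt (EuclideanSpace ℝ (Fin n)) c).symm y)
        * Real.sqrt (g.chartMatrix c y).det)).map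
      (chartAt (EuclideanSpace ℝ (Fin n)) c).symm

/-- The total volume `Vol(M, g)`. -/
def SmoothMetric.vol {n : ℕ} {M : Type*} [TopologicalSpace M]
    [ChartedSpace (EuclideanSpace ℝ (Fin n)) M] [IsManifold (𝓡 n) ∞ M]
    [T2Space M] [SigmaCompactSpace M] [MeasurableSpace M] [BorelSpace M]
    (g : SmoothMetric n M) : ENNReal :=
  g.volumeMeasure Set.univ

end

/-! The proof is a maximum principle. Write `g = e^{2f} g₀` with `R_{g₀} ≡ R₀ < 0`, and let `x` be a
minimum of `f`, which exists by compactness. There `df = 0` and `Δf ≥ 0`, so the conformal law `R_g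
= e^{-2f}(R₀ - 2(n-1)Δf - (n-1)(n-2)|df|²)` gives `-1/j ≤ R_g(x) ≤ e^{-2f(x)} R₀`. Hence `e^{2f} ≥
-j R₀` at `x`, and therefore everywhere. As `dV_g = e^{nf} dV_{g₀}`, it follows that `(-j R₀)^{n/2}
Vol(g₀) ≤ V₀`. Taking `R₀ = -1` gives (1); taking `Vol(g₀) = 1` gives (2).

The conformal law is needed only at critical points (`coordScalar_conformal`), where every term
quadratic in `df` drops out. The Christoffel symbols, however, are needed nearby, because they get
differentiated. No independence of charts is required: both curvatures at `x` are computed in the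
same chart, and both volumes use the same charts and partition of unity. -/

open Filter Topology

noncomputable section

/-! ### Smoothness of the inverse of a matrix-valued function -/

section MatrixSmooth

variable {E ι : Type*} [NormedAddCommGroup E] [NormedSpace ℝ E] [Fintype ι] [DecidableEq ι]
  {m : WithTop ℕ∞} {A : E → Matrix ι ι ℝ} {y : E}

theorem contDiffAt_matrix_det (hA : ∀ i j, ContDiffAt ℝ m (fun z => A z i j) y) :
    ContDiffAt ℝ m (fun z => (A z).det) y := by
  simp only [Matrix.det_apply']
  refine ContDiffAt.sum fun σ _ => contDiffAt_const.mul ?_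
  exact contDiffAt_prod fun i _ => hA _ _

/-- Cramer's rule: the adjugate entries are determinants of matrices with smooth entries. -/
theorem contDiffAt_matrix_inv (hA : ∀ i j, ContDiffAt ℝ m (fun z => A z i j) y)
    (hdet : (A y).det ≠ 0) (k l : ι) : ContDiffAt ℝ m (fun z => (A z)⁻¹ k l) y := by
  have hadj : ContDiffAt ℝ m (fun z => (A z).adjugate k l) y := by
    simp only [Matrix.adjugate_apply]
    refine contDiffAt_matrix_det fun i j => ?_
    simp only [Matrix.updateRow_apply]
    split_ifs
    · exact contDiffAt_const
    · exact hA i j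
  have hinv := ((contDiffAt_matrix_det hA).inv hdet).mul hadj
  simpa [Matrix.inv_def, Ring.inverse_eq_inv'] using hinv

end MatrixSmooth

variable {n : ℕ}

/-! ### Calculus of coordinate derivatives -/

section CoordDeriv

variable {F F' : EuclideanSpace ℝ (Fin n) → ℝ} {y : EuclideanSpace ℝ (Fin n)}

theorem coordDeriv_congr (i : Fin n) (h : F =ᶠ[𝓝 y] F') : coordDeriv i F y = coordDeriv i F' y := by
  rw [coordDeriv, coordDeriv, h.fderiv_eq]

theorem coordDeriv_add (i : Fin n) (hF : DifferentiableAt ℝ F y) (hF' : DifferentiableAt ℝ F' y) :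
    coordDeriv i (fun z => F z + F' z) y = coordDeriv i F y + coordDeriv i F' y := by
  simp only [coordDeriv]; rw [fderiv_fun_add hF hF']; rfl

theorem coordDeriv_mul (i : Fin n) (hF : DifferentiableAt ℝ F y) (hF' : DifferentiableAt ℝ F' y) :
    coordDeriv i (fun z => F z * F' z) y = F y * coordDeriv i F' y + F' y * coordDeriv i F y := by
  simp only [coordDeriv]; rw [fderiv_fun_mul hF hF']; rfl

theorem coordDeriv_sub (i : Fin n) (hF : DifferentiableAt ℝ F y) (hF' : DifferentiableAt ℝ F' y) :
    coordDeriv i (fun z => F z - F' z) y = coordDeriv i F y - coordDeriv i F' y := by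
  simp only [coordDeriv]; rw [fderiv_fun_sub hF hF']; rfl

theorem coordDeriv_sum {ι : Type*} (s : Finset ι) {F : ι → EuclideanSpace ℝ (Fin n) → ℝ}
    (i : Fin n) (hF : ∀ a ∈ s, DifferentiableAt ℝ (F a) y) :
    coordDeriv i (fun z => ∑ a ∈ s, F a z) y = ∑ a ∈ s, coordDeriv i (F a) y := by
  simp only [coordDeriv]; rw [fderiv_fun_sum hF]; simp

theorem coordDeriv_ite (i : Fin n) (p : Prop) [Decidable p] :
    coordDeriv i (fun z => if p then F z else 0) y = if p then coordDeriv i F y else 0 := by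
  split_ifs <;> simp [coordDeriv]

theorem coordDeriv_exp_two_mul (i : Fin n) (hF : DifferentiableAt ℝ F y) :
    coordDeriv i (fun z => Real.exp (2 * F z)) y = 2 * Real.exp (2 * F y) * coordDeriv i F y := by
  simp only [coordDeriv]
  rw [fderiv_exp (hF.const_mul 2), fderiv_const_mul hF]
  simp only [smul_apply, smul_eq_mul]; ring

theorem ContDiffAt.coordDeriv {m : WithTop ℕ∞} (hF : ContDiffAt ℝ (m + 1) F y) (i : Fin n) :
    ContDiffAt ℝ m (coordDeriv i F) y :=
  (hF.fderiv_right le_rfl).clm_apply contDiffAt_const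

end CoordDeriv

/-! ### Conformal change of the coordinate curvature -/

section Conformal

variable {G G₀ : EuclideanSpace ℝ (Fin n) → Matrix (Fin n) (Fin n) ℝ}
  {u : EuclideanSpace ℝ (Fin n) → ℝ} {y : EuclideanSpace ℝ (Fin n)}

theorem inv_conformal (hG : ∀ z, G z = Real.exp (2 * u z) • G₀ z) (hdet : (G₀ y).det ≠ 0) :
    (G y)⁻¹ = Real.exp (-(2 * u y)) • (G₀ y)⁻¹ := by
  rw [hG, Real.exp_neg]
  apply Matrix.inv_eq_left_inv
  rw [Matrix.smul_mul, Matrix.mul_smul, smul_smul, inv_mul_cancel₀ (Real.exp_ne_zero _), one_smul,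
    Matrix.nonsing_inv_mul _ (isUnit_iff_ne_zero.2 hdet)]

theorem sum_inv_mul_eq_ite {A : Matrix (Fin n) (Fin n) ℝ} (hA : A.PosDef) (k j : Fin n) :
    ∑ l, A⁻¹ k l * A j l = if k = j then 1 else 0 := by
  have h := congrFun (congrFun (Matrix.nonsing_inv_mul A (isUnit_iff_ne_zero.2 hA.det_pos.ne')) k) j
  rw [Matrix.mul_apply, Matrix.one_apply] at h
  rw [← h]
  refine Finset.sum_congr rfl fun l _ => ?_
  rw [show A j l = A l j by simpa using hA.isHermitian.apply l j]

/-- The Christoffel symbols of `e^{2u} G₀`. -/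
theorem coordChristoffel_conformal (hG : ∀ z, G z = Real.exp (2 * u z) • G₀ z)
    (hpos : (G₀ y).PosDef) (hu : DifferentiableAt ℝ u y)
    (hG₀ : ∀ i j, DifferentiableAt ℝ (fun z => G₀ z i j) y) (k i j : Fin n) :
    coordChristoffel G k i j y = coordChristoffel G₀ k i j y
      + (if k = j then coordDeriv i u y else 0) + (if k = i then coordDeriv j u y else 0)
      - G₀ y i j * ∑ l, (G₀ y)⁻¹ k l * coordDeriv l u y := by
  have hd : ∀ m a b, coordDeriv m (fun z => G z a b) y =
      Real.exp (2 * u y) * (coordDeriv m (fun z => G₀ z a b) y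
        + 2 * (G₀ y a b * coordDeriv m u y)) := by
    intro m a b
    have : (fun z => G z a b) = fun z => Real.exp (2 * u z) * G₀ z a b := by
      ext z; rw [hG]; rfl
    rw [this, coordDeriv_mul _ (by fun_prop) (hG₀ a b), coordDeriv_exp_two_mul _ hu]
    ring
  -- The Kronecker deltas are spread out as sums over `l`, so that the identity can be checked
  -- summand by summand.
  have hji : ∀ a b, (if a = b then coordDeriv i u y else 0) =
      ∑ l, ((G₀ y)⁻¹ a l * G₀ y b l) * coordDeriv i u y := by
    intro a b
    rw [← Finset.sum_mul, sum_inv_mul_eq_ite hpos]; simp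
  have hij : ∀ a b, (if a = b then coordDeriv j u y else 0) =
      ∑ l, ((G₀ y)⁻¹ a l * G₀ y b l) * coordDeriv j u y := by
    intro a b
    rw [← Finset.sum_mul, sum_inv_mul_eq_ite hpos]; simp
  rw [hji, hij]
  simp only [coordChristoffel, inv_conformal hG hpos.det_pos.ne', hd, Finset.mul_sum,
    ← Finset.sum_add_distrib, ← Finset.sum_sub_distrib]
  refine Finset.sum_congr rfl fun l _ => ?_
  have he : Real.exp (-(2 * u y)) * Real.exp (2 * u y) = 1 := by
    rw [← Real.exp_add]; simp
  simp only [Matrix.smul_apply, smul_eq_mul]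
  linear_combination (1 / 2 * (G₀ y)⁻¹ k l * (coordDeriv i (fun z => G₀ z j l) y
    + coordDeriv j (fun z => G₀ z i l) y - coordDeriv l (fun z => G₀ z i j) y
    + 2 * (G₀ y j l * coordDeriv i u y) + 2 * (G₀ y i l * coordDeriv j u y)
    - 2 * (G₀ y i j * coordDeriv l u y))) * he

theorem contDiffAt_coordChristoffel (hdet : (G₀ y).det ≠ 0)
    (hG₀ : ∀ i j, ContDiffAt ℝ 2 (fun z => G₀ z i j) y) (k i j : Fin n) :
    ContDiffAt ℝ 1 (coordChristoffel G₀ k i j) y := by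
  have hd : ∀ m a b, ContDiffAt ℝ 1 (coordDeriv m (fun z => G₀ z a b)) y := fun m a b =>
    ContDiffAt.coordDeriv (m := 1) (by simpa [one_add_one_eq_two] using hG₀ a b) m
  refine contDiffAt_const.mul (ContDiffAt.sum fun l _ => ?_)
  exact (contDiffAt_matrix_inv (fun a b => (hG₀ a b).of_le one_le_two) hdet k l).mul
    (((hd _ _ _).add (hd _ _ _)).sub (hd _ _ _))

/-- The derivative of the Christoffel symbols of `e^{2u} G₀` at a critical point of `u`. -/
theorem coordDeriv_coordChristoffel_conformal (hG : ∀ z, G z = Real.exp (2 * u z) • G₀ z)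
    (hpos : ∀ᶠ z in 𝓝 y, (G₀ z).PosDef) (hu : ContDiffAt ℝ 2 u y)
    (hG₀ : ∀ i j, ContDiffAt ℝ 2 (fun z => G₀ z i j) y) (hcrit : fderiv ℝ u y = 0)
    (m k i j : Fin n) :
    coordDeriv m (coordChristoffel G k i j) y = coordDeriv m (coordChristoffel G₀ k i j) y
      + (if k = j then coordDeriv m (coordDeriv i u) y else 0)
      + (if k = i then coordDeriv m (coordDeriv j u) y else 0)
      - G₀ y i j * ∑ l, (G₀ y)⁻¹ k l * coordDeriv m (coordDeriv l u) y := by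
  have hdet := hpos.self_of_nhds.det_pos.ne'
  -- Differentiating requires the formula on a neighbourhood, where `du` need not vanish.
  have hev : coordChristoffel G k i j =ᶠ[𝓝 y] fun z => coordChristoffel G₀ k i j z
      + (if k = j then coordDeriv i u z else 0) + (if k = i then coordDeriv j u z else 0)
      - G₀ z i j * ∑ l, (G₀ z)⁻¹ k l * coordDeriv l u z := by
    have h1 : ∀ᶠ z in 𝓝 y, ∀ i j, DifferentiableAt ℝ (fun z => G₀ z i j) z :=
      eventually_all.2 fun i => eventually_all.2 fun j =>
        ((hG₀ i j).eventually (by simp)).mono fun z hz => hz.differentiableAt (by simp)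
    filter_upwards [hpos, h1, hu.eventually (by simp)] with z hz1 hz2 hz3
    exact coordChristoffel_conformal hG hz1 (hz3.differentiableAt (by simp)) hz2 k i j
  have hdu : ∀ l, DifferentiableAt ℝ (coordDeriv l u) y := fun l =>
    (ContDiffAt.coordDeriv (m := 1) (by simpa [one_add_one_eq_two] using hu) l).differentiableAt
      (by simp)
  have hdu0 : ∀ l, coordDeriv l u y = 0 := fun l => by simp [coordDeriv, hcrit]
  have hΓ : DifferentiableAt ℝ (coordChristoffel G₀ k i j) y :=
    (contDiffAt_coordChristoffel hdet hG₀ k i j).differentiableAt (by simp)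
  have hinv : ∀ l, DifferentiableAt ℝ (fun z => (G₀ z)⁻¹ k l) y := fun l =>
    (contDiffAt_matrix_inv hG₀ hdet k l).differentiableAt (by simp)
  have hite : ∀ (p : Prop) [Decidable p] (l : Fin n),
      DifferentiableAt ℝ (fun z => if p then coordDeriv l u z else 0) y := by
    intro p _ l
    split_ifs
    · exact hdu l
    · exact differentiableAt_const _
  have hG₀' : DifferentiableAt ℝ (fun z => G₀ z i j) y := (hG₀ i j).differentiableAt (by simp)
  have hs : DifferentiableAt ℝ (fun z => ∑ l, (G₀ z)⁻¹ k l * coordDeriv l u z) y :=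
    DifferentiableAt.fun_sum fun l _ => (hinv l).fun_mul (hdu l)
  have hΓ' := hΓ.fun_add (hite (k = j) i)
  rw [coordDeriv_congr m hev, coordDeriv_sub _ (hΓ'.fun_add (hite (k = i) j)) (hG₀'.fun_mul hs),
    coordDeriv_add _ hΓ' (hite _ _), coordDeriv_add _ hΓ (hite _ _),
    coordDeriv_ite, coordDeriv_ite, coordDeriv_mul _ hG₀' hs,
    coordDeriv_sum _ _ fun l _ => (hinv l).fun_mul (hdu l)]
  -- Since `du = 0` at `y`, product-rule terms with the derivative on `G₀` or its inverse vanish;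
  -- only the Hessian of `u` survives.
  simp only [hdu0, mul_zero, zero_mul, Finset.sum_const_zero, add_zero]
  congr 2
  refine Finset.sum_congr rfl fun l _ => ?_
  rw [coordDeriv_mul _ (hinv l) (hdu l), hdu0]; ring

/-- The Ricci curvature of `e^{2u} G₀` at a critical point of `u`. -/
theorem coordRicci_conformal (hG : ∀ z, G z = Real.exp (2 * u z) • G₀ z)
    (hpos : ∀ᶠ z in 𝓝 y, (G₀ z).PosDef) (hu : ContDiffAt ℝ 2 u y)
    (hG₀ : ∀ i j, ContDiffAt ℝ 2 (fun z => G₀ z i j) y) (hcrit : fderiv ℝ u y = 0)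
    (j k : Fin n) :
    coordRicci G j k y = coordRicci G₀ j k y + coordDeriv k (coordDeriv j u) y
      + (1 - n) * coordDeriv j (coordDeriv k u) y
      - G₀ y j k * ∑ i, ∑ l, (G₀ y)⁻¹ i l * coordDeriv i (coordDeriv l u) y := by
  have hp := hpos.self_of_nhds
  have hdu0 : ∀ l, coordDeriv l u y = 0 := fun l => by simp [coordDeriv, hcrit]
  have hΓ : ∀ a b c, coordChristoffel G a b c y = coordChristoffel G₀ a b c y := by
    intro a b c
    rw [coordChristoffel_conformal hG hp (hu.differentiableAt (by simp))
      (fun i j => (hG₀ i j).differentiableAt (by simp))]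
    simp [hdu0]
  have hcontract : ∑ i, G₀ y i k * ∑ l, (G₀ y)⁻¹ i l * coordDeriv j (coordDeriv l u) y
      = coordDeriv j (coordDeriv k u) y := by
    simp only [Finset.mul_sum]
    rw [Finset.sum_comm]
    have : ∀ l, ∑ i, G₀ y i k * ((G₀ y)⁻¹ i l * coordDeriv j (coordDeriv l u) y)
        = if l = k then coordDeriv j (coordDeriv l u) y else 0 := by
      intro l
      have h := sum_inv_mul_eq_ite hp l k
      rw [show (if l = k then coordDeriv j (coordDeriv l u) y else 0)
        = (if l = k then 1 else 0) * coordDeriv j (coordDeriv l u) y by simp, ← h, Finset.sum_mul]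
      refine Finset.sum_congr rfl fun i _ => ?_
      rw [show G₀ y k i = G₀ y i k by simpa using hp.isHermitian.apply i k,
        show (G₀ y)⁻¹ l i = (G₀ y)⁻¹ i l by simpa using hp.inv.isHermitian.apply i l]
      ring
    simp [this]
  simp only [coordRicci, hΓ, coordDeriv_coordChristoffel_conformal hG hpos hu hG₀ hcrit]
  rw [Finset.mul_sum]
  -- The coefficient is `1 - n - 1 + 1`: one delta term from `∂ᵢΓⁱⱼₖ`, then the trace, the delta and
  -- the contracted metric term from `-∂ⱼΓⁱᵢₖ`.
  have hL : (1 - (n : ℝ)) * coordDeriv j (coordDeriv k u) y =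
      (∑ i, if i = j then coordDeriv i (coordDeriv k u) y else 0)
      - (∑ _i : Fin n, coordDeriv j (coordDeriv k u) y)
      - (∑ i, if i = k then coordDeriv j (coordDeriv i u) y else 0)
      + ∑ i, G₀ y i k * ∑ l, (G₀ y)⁻¹ i l * coordDeriv j (coordDeriv l u) y := by
    rw [hcontract]; simp; ring
  have hK : coordDeriv k (coordDeriv j u) y =
      ∑ i, if i = k then coordDeriv i (coordDeriv j u) y else 0 := by simp
  rw [hL, hK]
  simp only [← Finset.sum_add_distrib, ← Finset.sum_sub_distrib]
  refine Finset.sum_congr rfl fun i _ => ?_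
  simp only [if_true]
  ring

/-- The scalar curvature of `e^{2u} G₀` at a critical point of `u`. -/
theorem coordScalar_conformal (hG : ∀ z, G z = Real.exp (2 * u z) • G₀ z)
    (hpos : ∀ᶠ z in 𝓝 y, (G₀ z).PosDef) (hu : ContDiffAt ℝ 2 u y)
    (hG₀ : ∀ i j, ContDiffAt ℝ 2 (fun z => G₀ z i j) y) (hcrit : fderiv ℝ u y = 0) :
    coordScalar G y = Real.exp (-(2 * u y)) * (coordScalar G₀ y
      - 2 * (n - 1) * ∑ i, ∑ l, (G₀ y)⁻¹ i l * coordDeriv i (coordDeriv l u) y) := by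
  have hp := hpos.self_of_nhds
  set S := ∑ i, ∑ l, (G₀ y)⁻¹ i l * coordDeriv i (coordDeriv l u) y with hS
  -- Symmetry of `G₀⁻¹` suffices here; the second derivatives need not be commuted.
  have hS' : ∑ j, ∑ k, (G₀ y)⁻¹ j k * coordDeriv k (coordDeriv j u) y = S := by
    rw [Finset.sum_comm, hS]
    refine Finset.sum_congr rfl fun k _ => Finset.sum_congr rfl fun j _ => ?_
    rw [show (G₀ y)⁻¹ j k = (G₀ y)⁻¹ k j by simpa using hp.inv.isHermitian.apply k j]
  have htr : ∑ j, ∑ k, (G₀ y)⁻¹ j k * G₀ y j k = n := by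
    simp [sum_inv_mul_eq_ite hp]
  have hexp : coordScalar G y = Real.exp (-(2 * u y)) * (coordScalar G₀ y
      + ∑ j, ∑ k, (G₀ y)⁻¹ j k * coordDeriv k (coordDeriv j u) y
      + (1 - n) * ∑ j, ∑ k, (G₀ y)⁻¹ j k * coordDeriv j (coordDeriv k u) y
      - (∑ j, ∑ k, (G₀ y)⁻¹ j k * G₀ y j k) * S) := by
    have hRic : ∀ j k, coordRicci G j k y = coordRicci G₀ j k y
        + coordDeriv k (coordDeriv j u) y + (1 - n) * coordDeriv j (coordDeriv k u) y
        - G₀ y j k * S := fun j k => coordRicci_conformal hG hpos hu hG₀ hcrit j k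
    clear_value S
    simp only [coordScalar, inv_conformal hG hp.det_pos.ne', hRic, Finset.mul_sum, Finset.sum_mul,
      ← Finset.sum_add_distrib, ← Finset.sum_sub_distrib, Matrix.smul_apply, smul_eq_mul]
    refine Finset.sum_congr rfl fun j _ => Finset.sum_congr rfl fun k _ => ?_
    ring
  rw [hexp, hS', htr, ← hS]; ring

end Conformal

/-! ### Second derivatives at a local minimum -/

section LocalMin

/-- Were the second derivative negative, `t` would also be a local maximum, so `h` would be locally
constant and its second derivative zero. -/
theorem IsLocalMin.deriv_deriv_nonneg {h : ℝ → ℝ} {t : ℝ} (hmin : IsLocalMin h t)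
    (hc : ContinuousAt h t) : 0 ≤ deriv (deriv h) t := by
  by_contra! hneg
  have hmax := isLocalMax_of_deriv_deriv_neg hneg hmin.deriv_eq_zero hc
  have hconst : h =ᶠ[𝓝 t] fun _ => h t := by
    filter_upwards [hmin, hmax] with s h1 h2 using le_antisymm h2 h1
  have : deriv (deriv h) t = 0 := by
    rw [hconst.deriv.deriv_eq]; simp
  linarith

/-- Restriction to the line `t ↦ y + t v` reduces this to one variable. -/
theorem IsLocalMin.fderiv_fderiv_nonneg {E : Type*} [NormedAddCommGroup E] [NormedSpace ℝ E]
    {u : E → ℝ} {y : E} (hmin : IsLocalMin u y) (hu : ContDiffAt ℝ 2 u y) (v : E) :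
    0 ≤ fderiv ℝ (fderiv ℝ u) y v v := by
  set c : ℝ → E := fun t => y + t • v with hc
  have hcd : ∀ t, HasDerivAt c v t := fun t => by
    have := ((hasDerivAt_id t).smul_const v).const_add y
    rwa [one_smul] at this
  have hc0 : c 0 = y := by simp [hc]
  have hcc : Tendsto c (𝓝 0) (𝓝 y) := by
    have := (hcd 0).continuousAt.tendsto
    rwa [hc0] at this
  have h1 : deriv (u ∘ c) =ᶠ[𝓝 0] fun t => fderiv ℝ u (c t) v := by
    filter_upwards [hcc.eventually (hu.eventually (by simp))] with t ht
    exact ((ht.differentiableAt (by simp)).hasFDerivAt.comp_hasDerivAt t (hcd t)).deriv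
  have hfd : DifferentiableAt ℝ (fderiv ℝ u) (c 0) := by
    rw [hc0]
    exact (hu.fderiv_right (m := 1) (by simp [one_add_one_eq_two])).differentiableAt (by simp)
  have h2 : deriv (deriv (u ∘ c)) 0 = fderiv ℝ (fderiv ℝ u) y v v := by
    rw [h1.deriv_eq]
    have := (hfd.hasFDerivAt.comp_hasDerivAt 0 (hcd 0)).clm_apply (hasDerivAt_const 0 v)
    simpa [hc0] using this.deriv
  rw [← h2]
  refine IsLocalMin.deriv_deriv_nonneg ?_ ?_
  · have := hcc.eventually hmin
    simpa [IsLocalMin, IsMinFilter, hc0] using this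
  · exact ContinuousAt.comp (by rw [hc0]; exact hu.continuousAt) (hcd 0).continuousAt

/-- The trace of the Hessian at a local minimum, with respect to a positive semidefinite form, is
nonnegative. -/
theorem IsLocalMin.sum_mul_coordDeriv_nonneg {u : EuclideanSpace ℝ (Fin n) → ℝ}
    {y : EuclideanSpace ℝ (Fin n)} (hmin : IsLocalMin u y) (hu : ContDiffAt ℝ 2 u y)
    {A : Matrix (Fin n) (Fin n) ℝ} (hA : A.PosSemidef) :
    0 ≤ ∑ i, ∑ l, A i l * coordDeriv i (coordDeriv l u) y := by
  have hfd : DifferentiableAt ℝ (fderiv ℝ u) y :=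
    (hu.fderiv_right (m := 1) (by simp [one_add_one_eq_two])).differentiableAt (by simp)
  have hess : ∀ i l, coordDeriv i (coordDeriv l u) y =
      fderiv ℝ (fderiv ℝ u) y (EuclideanSpace.single i 1) (EuclideanSpace.single l 1) := by
    intro i l
    have : coordDeriv l u = fun z => fderiv ℝ u z (EuclideanSpace.single l 1) := rfl
    rw [this, coordDeriv, fderiv_clm_apply hfd (differentiableAt_const _)]
    simp
  -- With `A = Bᴴ B`, the trace is the sum of the Hessian's quadratic form over the rows of `B`.
  obtain ⟨B, rfl⟩ : ∃ B : Matrix (Fin n) (Fin n) ℝ, A = B.conjTranspose * B := by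
    open scoped MatrixOrder in
    exact CStarAlgebra.nonneg_iff_eq_star_mul_self.1 hA.nonneg
  have key : ∑ i, ∑ l, (B.conjTranspose * B) i l * coordDeriv i (coordDeriv l u) y =
      ∑ a, fderiv ℝ (fderiv ℝ u) y (∑ i, B a i • EuclideanSpace.single i 1)
        (∑ l, B a l • EuclideanSpace.single l 1) := by
    simp only [hess, map_sum, map_smul, sum_apply,
      smul_apply, smul_eq_mul, Matrix.mul_apply, Matrix.conjTranspose_apply,
      star_trivial, Finset.sum_mul, Finset.mul_sum]
    calc _ = ∑ i, ∑ a, ∑ l, B a i * B a l * fderiv ℝ (fderiv ℝ u) y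
          (EuclideanSpace.single i 1) (EuclideanSpace.single l 1) :=
            Finset.sum_congr rfl fun i _ => Finset.sum_comm
      _ = ∑ a, ∑ i, ∑ l, B a i * B a l * fderiv ℝ (fderiv ℝ u) y
          (EuclideanSpace.single i 1) (EuclideanSpace.single l 1) := Finset.sum_comm
      _ = _ := by
        refine Finset.sum_congr rfl fun a _ => ?_
        rw [Finset.sum_comm]
        refine Finset.sum_congr rfl fun l _ => Finset.sum_congr rfl fun i _ => ?_
        ring
  rw [key]
  exact Finset.sum_nonneg fun a _ => hmin.fderiv_fderiv_nonneg hu _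

/-- At a local minimum of `u`, the scalar curvature of `e^{2u} G₀` is at most `e^{-2u}` times that
of `G₀`. -/
theorem coordScalar_conformal_le {G G₀ : EuclideanSpace ℝ (Fin n) → Matrix (Fin n) (Fin n) ℝ}
    {u : EuclideanSpace ℝ (Fin n) → ℝ} {y : EuclideanSpace ℝ (Fin n)} (hn : 1 ≤ n)
    (hG : ∀ z, G z = Real.exp (2 * u z) • G₀ z)
    (hpos : ∀ᶠ z in 𝓝 y, (G₀ z).PosDef) (hu : ContDiffAt ℝ 2 u y)
    (hG₀ : ∀ i j, ContDiffAt ℝ 2 (fun z => G₀ z i j) y) (hmin : IsLocalMin u y) :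
    coordScalar G y ≤ Real.exp (-(2 * u y)) * coordScalar G₀ y := by
  rw [coordScalar_conformal hG hpos hu hG₀ hmin.fderiv_eq_zero]
  have h := hmin.sum_mul_coordDeriv_nonneg hu hpos.self_of_nhds.inv.posSemidef
  have hn' : (1 : ℝ) ≤ n := by exact_mod_cast hn
  gcongr
  nlinarith [mul_nonneg (sub_nonneg.2 hn') h]

end LocalMin

end

noncomputable section

/-! ### Regularity of the coefficients of a metric -/

namespace SmoothMetric

variable {n : ℕ} {M : Type*} [TopologicalSpace M]
  [ChartedSpace (EuclideanSpace ℝ (Fin n)) M] [IsManifold (𝓡 n) ∞ M]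

/-- On the chart's target the differential of `φ⁻¹` is injective, so this is the Gram matrix of
independent vectors. -/
theorem chartMatrix_posDef (g : SmoothMetric n M) (c : M) {y : EuclideanSpace ℝ (Fin n)}
    (hy : y ∈ (chartAt (EuclideanSpace ℝ (Fin n)) c).target) : (g.chartMatrix c y).PosDef := by
  have : IsManifold (𝓡 n) 1 M := IsManifold.of_le (n := ∞) (by simp)
  set φ := chartAt (EuclideanSpace ℝ (Fin n)) c
  set D := mfderiv (𝓡 n) (𝓡 n) φ.symm y with hD
  have hinj : Function.Injective D :=
    (mdifferentiable_chart (I := 𝓡 n) c).symm.mfderiv_injective hy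
  refine Matrix.PosDef.of_dotProduct_mulVec_pos ?_ ?_
  · ext i j
    simp only [Matrix.conjTranspose_apply, chartMatrix, Matrix.of_apply, star_trivial]
    exact g.symm _ _ _
  · intro x hx
    have hx' : (∑ i, x i • EuclideanSpace.single i (1 : ℝ) : EuclideanSpace ℝ (Fin n)) ≠ 0 := by
      intro h
      apply hx
      ext k
      have := congrArg (fun v : EuclideanSpace ℝ (Fin n) => v k) h
      simpa [Finset.sum_apply, Pi.single_apply] using this
    have hne : D (∑ i, x i • EuclideanSpace.single i (1 : ℝ) : EuclideanSpace ℝ (Fin n)) ≠ 0 := by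
      intro h
      exact hx' (hinj (h.trans (map_zero D).symm))
    have hpos := g.pos _ _ hne
    have hexp : D (∑ i, x i • EuclideanSpace.single i (1 : ℝ) : EuclideanSpace ℝ (Fin n))
        = ∑ i, x i • D (EuclideanSpace.single i (1 : ℝ) : EuclideanSpace ℝ (Fin n)) := by
      erw [map_sum]
      exact Finset.sum_congr rfl fun i _ => D.map_smul _ _
    rw [hexp] at hpos
    simp only [map_sum, map_smul, sum_apply, smul_apply, smul_eq_mul] at hpos
    simp only [dotProduct, Matrix.mulVec, chartMatrix, Matrix.of_apply, star_trivial,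
      Finset.mul_sum]
    refine hpos.trans_eq ?_
    refine Finset.sum_congr rfl fun i _ => ?_
    rw [Finset.mul_sum]
    refine Finset.sum_congr rfl fun l _ => ?_
    rw [g.symm]
    simp only [hD, φ]
    ring

/-- The coordinate fields are smooth, being the tangent map of `φ⁻¹` applied to constant fields, and
`g` is a smooth bilinear form on the tangent bundle. -/
theorem contDiffAt_chartMatrix (g : SmoothMetric n M) (c : M) {y : EuclideanSpace ℝ (Fin n)}
    (hy : y ∈ (chartAt (EuclideanSpace ℝ (Fin n)) c).target) (i j : Fin n) :
    ContDiffAt ℝ ∞ (fun z => g.chartMatrix c z i j) y := by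
  have : IsManifold (𝓡 n) 1 M := IsManifold.of_le (n := ∞) (by simp)
  set φ := chartAt (EuclideanSpace ℝ (Fin n)) c
  have ht : φ.target ∈ 𝓝 y := φ.open_target.mem_nhds hy
  have hsymm : ContMDiffOn (𝓡 n) (𝓡 n) ∞ φ.symm φ.target := contMDiffOn_chart_symm
  have hb : ContMDiffAt (𝓡 n) (𝓡 n) ∞ φ.symm y := hsymm.contMDiffAt ht
  have hT := hsymm.contMDiffOn_tangentMapWithin (m := ∞) (by simp) φ.open_target.uniqueMDiffOn
  have hv : ∀ v : EuclideanSpace ℝ (Fin n), ContMDiffAt 𝓘(ℝ, EuclideanSpace ℝ (Fin n))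
      ((𝓡 n).prod 𝓘(ℝ, EuclideanSpace ℝ (Fin n))) ∞
      (fun z => Bundle.TotalSpace.mk' (EuclideanSpace ℝ (Fin n))
        (E := (TangentSpace (𝓡 n) : M → Type _)) (φ.symm z)
        (mfderiv (𝓡 n) (𝓡 n) φ.symm z v)) y := by
    intro v
    have hc : ContMDiff 𝓘(ℝ, EuclideanSpace ℝ (Fin n))
        ((𝓡 n).prod 𝓘(ℝ, EuclideanSpace ℝ (Fin n))) ∞
        (fun z : EuclideanSpace ℝ (Fin n) => (⟨z, v⟩ : TangentBundle (𝓡 n) (EuclideanSpace ℝ (Fin n)))) := by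
      exact (contMDiff_vectorSpace_iff_contDiff (V := fun _ => v)).2 contDiff_const
    have hcomp := (hT.comp (s := φ.target) hc.contMDiffOn (fun z hz => hz)).contMDiffAt ht
    refine hcomp.congr_of_eventuallyEq ?_
    filter_upwards [ht] with z hz
    simp [tangentMapWithin, mfderivWithin_of_isOpen φ.open_target hz]
  have hg := g.contMDiff.contMDiffAt.comp y hb
  have := ContMDiffAt.clm_bundle_apply₂ (F₁ := EuclideanSpace ℝ (Fin n))
    (F₂ := EuclideanSpace ℝ (Fin n)) (E₃ := fun _ : M => ℝ) hg
    (hv (EuclideanSpace.single i 1)) (hv (EuclideanSpace.single j 1))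
  exact (Bundle.contMDiffAt_totalSpace.1 this).2.contDiffAt

theorem chartMatrix_eq_smul {g g₀ : SmoothMetric n M} {f : M → ℝ}
    (hf : ∀ (x : M) (v w : TangentSpace (𝓡 n) x),
      g.inner x v w = Real.exp (2 * f x) * g₀.inner x v w) (c : M)
    (y : EuclideanSpace ℝ (Fin n)) :
    g.chartMatrix c y = Real.exp (2 * f ((chartAt (EuclideanSpace ℝ (Fin n)) c).symm y)) •
      g₀.chartMatrix c y := by
  ext i j
  exact hf _ _ _

end SmoothMetric
end

noncomputable section

namespace SmoothMetric

variable {n : ℕ} {M : Type*} [TopologicalSpace M]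
  [ChartedSpace (EuclideanSpace ℝ (Fin n)) M] [IsManifold (𝓡 n) ∞ M]

/-! ### The maximum principle for the conformal factor -/

/-- At a minimum of `f`, the scalar curvature of `e^{2f} g₀` is at most `e^{-2f}` times that of
`g₀`. -/
theorem scalarCurvature_conformal_le (hn : 1 ≤ n) {g g₀ : SmoothMetric n M} {f : M → ℝ}
    (hf : ContMDiff (𝓡 n) 𝓘(ℝ, ℝ) 2 f)
    (hg : ∀ (x : M) (v w : TangentSpace (𝓡 n) x),
      g.inner x v w = Real.exp (2 * f x) * g₀.inner x v w)
    {x : M} (hmin : ∀ z, f x ≤ f z) :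
    g.scalarCurvature x ≤ Real.exp (-(2 * f x)) * g₀.scalarCurvature x := by
  set φ := chartAt (EuclideanSpace ℝ (Fin n)) x
  have hsrc : x ∈ φ.source := mem_chart_source _ x
  have htgt : φ x ∈ φ.target := φ.map_source hsrc
  have hx : φ.symm (φ x) = x := φ.left_inv hsrc
  have hsymm : ContMDiffAt (𝓡 n) (𝓡 n) 2 φ.symm (φ x) :=
    ((contMDiffOn_chart_symm (I := 𝓡 n) (n := ∞) (x := x)).contMDiffAt
      (φ.open_target.mem_nhds htgt)).of_le (ENat.LEInfty.out)
  have hu : ContDiffAt ℝ 2 (fun y => f (φ.symm y)) (φ x) :=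
    (hf.contMDiffAt.comp (φ x) hsymm).contDiffAt
  have hpos : ∀ᶠ z in 𝓝 (φ x), (g₀.chartMatrix x z).PosDef := by
    filter_upwards [φ.open_target.mem_nhds htgt] with z hz using g₀.chartMatrix_posDef x hz
  have h := coordScalar_conformal_le hn (chartMatrix_eq_smul hg x) hpos hu
    (fun i j => (g₀.contDiffAt_chartMatrix x htgt i j).of_le (ENat.LEInfty.out))
    -- The minimum is global, so the inequality holds even at `y` outside the chart's target.
    (Eventually.of_forall fun y => (congrArg f hx).trans_le (hmin _))
  rwa [hx] at h

/-- If `e^{2f} g₀` has scalar curvature at least `-a` and `g₀` has constant negative scalar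
curvature `R₀`, then `e^{2f} ≥ -R₀ / a`. -/
theorem neg_le_mul_exp_of_conformal [CompactSpace M] (hn : 1 ≤ n) {g g₀ : SmoothMetric n M}
    {f : M → ℝ} (hf : ContMDiff (𝓡 n) 𝓘(ℝ, ℝ) 2 f)
    (hg : ∀ (x : M) (v w : TangentSpace (𝓡 n) x),
      g.inner x v w = Real.exp (2 * f x) * g₀.inner x v w)
    {a R₀ : ℝ} (ha : 0 ≤ a) (hR : ∀ x, -a ≤ g.scalarCurvature x)
    (hR₀ : ∀ x, g₀.scalarCurvature x = R₀) (z : M) : -R₀ ≤ a * Real.exp (2 * f z) := by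
  -- The given point `z` supplies the nonemptiness needed for a minimum.
  obtain ⟨x, -, hx⟩ := isCompact_univ.exists_isMinOn ⟨z, Set.mem_univ z⟩
    hf.continuous.continuousOn
  have hmin : ∀ w, f x ≤ f w := fun w => hx (Set.mem_univ w)
  have h := (hR x).trans (scalarCurvature_conformal_le hn hf hg hmin)
  rw [hR₀, Real.exp_neg, inv_mul_eq_div, le_div_iff₀ (Real.exp_pos _)] at h
  have hexp : Real.exp (2 * f x) ≤ Real.exp (2 * f z) :=
    Real.exp_le_exp.2 (by linarith [hmin z])
  nlinarith [mul_le_mul_of_nonneg_left hexp ha]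

/-! ### Comparison of volumes -/

variable [T2Space M] [SigmaCompactSpace M] [MeasurableSpace M] [BorelSpace M]

/-- In this form two volumes differ only in the determinants, so they can be compared integrand by
integrand. -/
theorem vol_eq_tsum (g : SmoothMetric n M) :
    g.vol = ∑' c : M, ∫⁻ y in (chartAt (EuclideanSpace ℝ (Fin n)) c).target,
      ENNReal.ofReal (chartPartition n M c ((chartAt (EuclideanSpace ℝ (Fin n)) c).symm y)
        * Real.sqrt (g.chartMatrix c y).det) := by
  rw [vol, volumeMeasure, MeasureTheory.Measure.sum_apply _ MeasurableSet.univ]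
  refine tsum_congr fun c => ?_
  set φ := chartAt (EuclideanSpace ℝ (Fin n)) c
  have hm : AEMeasurable φ.symm (MeasureTheory.volume.restrict φ.target) :=
    φ.symm.continuousOn.aemeasurable φ.open_target.measurableSet
  rw [MeasureTheory.Measure.map_apply_of_aemeasurable
    (hm.mono_ac (MeasureTheory.withDensity_absolutelyContinuous _ _)) MeasurableSet.univ,
    Set.preimage_univ, MeasureTheory.withDensity_apply _ MeasurableSet.univ,
    MeasureTheory.Measure.restrict_univ]

/-- If `e^{2f} ≥ b ≥ 0`, then the volume of `e^{2f} g₀` is at least `b^{n/2}` times that of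
`g₀`. -/
theorem rpow_mul_vol_le_vol_conformal {g g₀ : SmoothMetric n M} {f : M → ℝ}
    (hg : ∀ (x : M) (v w : TangentSpace (𝓡 n) x),
      g.inner x v w = Real.exp (2 * f x) * g₀.inner x v w)
    {b : ℝ} (hb : 0 ≤ b) (hf : ∀ x, b ≤ Real.exp (2 * f x)) :
    ENNReal.ofReal (b ^ ((n : ℝ) / 2)) * g₀.vol ≤ g.vol := by
  -- Scaling an `n × n` matrix by `e^{2f}` multiplies its determinant by `(e^{2f})^n ≥ b^n`.
  have hroot : b ^ ((n : ℝ) / 2) = Real.sqrt (b ^ n) := by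
    rw [Real.sqrt_eq_rpow, ← Real.rpow_natCast, ← Real.rpow_mul hb]
    ring_nf
  rw [vol_eq_tsum, vol_eq_tsum, ← ENNReal.tsum_mul_left]
  refine ENNReal.tsum_le_tsum fun c => ?_
  rw [← MeasureTheory.lintegral_const_mul' _ _ ENNReal.ofReal_ne_top]
  refine MeasureTheory.lintegral_mono fun y => ?_
  rw [← ENNReal.ofReal_mul (by positivity)]
  refine ENNReal.ofReal_le_ofReal ?_
  have hρ := (chartPartition n M).nonneg c ((chartAt (EuclideanSpace ℝ (Fin n)) c).symm y)
  rw [chartMatrix_eq_smul hg, Matrix.det_smul, Fintype.card_fin, Real.sqrt_mul (by positivity),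
    hroot, mul_left_comm]
  gcongr
  exact hf _

end SmoothMetric

end

/-! ### The volume and curvature bounds -/

theorem theorem1p3 {n : ℕ} (hn : 3 ≤ n) {M : Type*} [TopologicalSpace M]
    [ChartedSpace (EuclideanSpace ℝ (Fin n)) M] [IsManifold (𝓡 n) ∞ M]
    [T2Space M] [CompactSpace M] [MeasurableSpace M] [BorelSpace M]
    (g : ℕ → SmoothMetric n M) (V₀ : ℝ)
    (hR : ∀ j : ℕ, 1 ≤ j → ∀ x : M, -(1 / (j : ℝ)) ≤ (g j).scalarCurvature x)
    (hV : ∀ j : ℕ, 1 ≤ j → (g j).vol ≤ ENNReal.ofReal V₀) :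
    ∀ j : ℕ, 1 ≤ j →
      (∀ g₀ : SmoothMetric n M, (g j).IsConformalTo g₀ →
        (∀ x : M, g₀.scalarCurvature x = -1) →
          g₀.vol ≤ ENNReal.ofReal (V₀ / (j : ℝ) ^ ((n : ℝ) / 2)) ∧
          g₀.vol ≤ ENNReal.ofReal (V₀ / (j : ℝ) ^ ((3 : ℝ) / 2))) ∧
      (∀ (g₁ : SmoothMetric n M) (R₁ : ℝ), (g j).IsConformalTo g₁ → R₁ < 0 →
        (∀ x : M, g₁.scalarCurvature x = R₁) → g₁.vol = 1 →
          -(V₀ ^ ((2 : ℝ) / (n : ℝ)) / (j : ℝ)) ≤ R₁ ∧ R₁ < 0) := by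
  intro j hj
  have hj1 : (1 : ℝ) ≤ j := by exact_mod_cast hj
  have hj0 : (0 : ℝ) < j := by linarith
  have hn3 : (3 : ℝ) ≤ n := by exact_mod_cast hn
  have key : ∀ (g₀ : SmoothMetric n M) (R₀ : ℝ), (g j).IsConformalTo g₀ → R₀ < 0 →
      (∀ x : M, g₀.scalarCurvature x = R₀) →
      ENNReal.ofReal ((j * -R₀) ^ ((n : ℝ) / 2)) * g₀.vol ≤ ENNReal.ofReal V₀ := by
    rintro g₀ R₀ ⟨f, hf, hg⟩ hR₀ hscal
    refine (SmoothMetric.rpow_mul_vol_le_vol_conformal hg (by nlinarith) fun x => ?_).trans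
      (hV j hj)
    have h := SmoothMetric.neg_le_mul_exp_of_conformal (by omega) hf hg (by positivity)
      (hR j hj) hscal x
    rwa [one_div, inv_mul_eq_div, le_div_iff₀' hj0] at h
  refine ⟨fun g₀ hconf hscal => ?_, fun g₁ R₁ hconf hR₁ hscal hvol => ⟨?_, hR₁⟩⟩
  · have h1 : g₀.vol ≤ ENNReal.ofReal (V₀ / (j : ℝ) ^ ((n : ℝ) / 2)) := by
      have hpow : 0 < (j : ℝ) ^ ((n : ℝ) / 2) := Real.rpow_pos_of_pos hj0 _
      have h := key g₀ (-1) hconf (by norm_num) hscal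
      rw [neg_neg, mul_one, mul_comm] at h
      rw [ENNReal.ofReal_div_of_pos hpow]
      exact (ENNReal.le_div_iff_mul_le (Or.inl (ENNReal.ofReal_pos.2 hpow).ne')
        (Or.inl ENNReal.ofReal_ne_top)).2 h
    refine ⟨h1, h1.trans ?_⟩
    -- For `V₀ ≤ 0` the real quotients compare the wrong way, but `ENNReal.ofReal` truncates them to
    -- `0`.
    rcases le_total 0 V₀ with hV₀ | hV₀
    · refine ENNReal.ofReal_le_ofReal (div_le_div_of_nonneg_left hV₀ (by positivity) ?_)
      exact Real.rpow_le_rpow_of_exponent_le hj1 (by linarith)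
    · rw [ENNReal.ofReal_of_nonpos (div_nonpos_of_nonpos_of_nonneg hV₀ (by positivity))]
      exact zero_le
  · have hc : 0 < (j : ℝ) * -R₁ := mul_pos hj0 (by linarith)
    have h := key g₁ R₁ hconf hR₁ hscal
    rw [hvol, mul_one] at h
    have h' : (j * -R₁) ^ ((n : ℝ) / 2) ≤ V₀ := by
      -- Here `V₀ ≤ 0` is impossible: it would force a positive power to be nonpositive.
      rcases le_total 0 V₀ with hV₀ | hV₀
      · exact (ENNReal.ofReal_le_ofReal_iff hV₀).1 h
      · rw [ENNReal.ofReal_of_nonpos hV₀, nonpos_iff_eq_zero, ENNReal.ofReal_eq_zero] at h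
        exact absurd (Real.rpow_pos_of_pos hc _) h.not_gt
    have h2 := Real.rpow_le_rpow (by positivity) h' (by positivity : (0 : ℝ) ≤ 2 / n)
    have hn0 : (n : ℝ) ≠ 0 := by linarith
    rw [← Real.rpow_mul hc.le, show (n : ℝ) / 2 * (2 / n) = 1 by field_simp, Real.rpow_one] at h2
    rw [neg_le, le_div_iff₀' hj0]
    exact h2
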